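/- Let $\{\varphi_n\}$ ($n\in\mathbb N$ or $n\in\mathbb Z$) be an orthonormal system in the complex space $L_2=L_2(0,1)$ with $M:=\sup_n\|\varphi_n\|_{L_\infty}<\infty$ (so that $M\ge 1$). For a measurable function $f$ on $[0,1]$ let $f^*(u)=\inf\{s\ge 0: |\{x\in[0,1]:|f(x)|>s\}|\le u\}$ be its non-increasing rearrangement, and for a family $c=\{c_n\}$ of complex numbers let $c_k^*=\inf\{s\ge 0:\#\{n:|c_n|>s\}\le k-1\}$, $k=1,2,\dots$, be its non-increasing rearrangement. For $0<q\le\infty$ and $\alpha\in\mathbb R$ put $$\|f\|_{L^{\mathcal L}_{2,q,\alpha,2}}=\left(\int_0^1\Big[(1+|\log t|)^\alpha\Big(\int_0^t f^*(u)^2\,du\Big)^{1/2}\Big]^q\frac{dt}{t}\right)^{1/q},$$ $$\|c\|_{l^{\mathcal R}_{2,q,\alpha,2}}=\left(\sum_{k=1}^\infty\Big[(1+\log k)^\alpha\Big(\sum_{i=k}^\infty (c_i^*)^2\Big)^{1/2}\Big]^q\frac1k\right)^{1/q},$$ where for $q=\infty$ the outer integral and the outer sum are replaced by the suprema over $0<t<1$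 and $k\ge1$ of the expressions in square brackets, and $1/q=0$. **Theorem 1.2.** Let $0<q\le\infty$, $\alpha>-1/q$ and $\varepsilon>0$. There is a constant $C$ depending only on $q$, $\alpha$ and $\varepsilon$ such that, for every such system $\{\varphi_n\}$ and every $c$ with $\|c\|_{l^{\mathcal R}_{2,q,\alpha,2}}<\infty$, the series $\sum_n c_n\varphi_n$ converges unconditionally in $L_2$, and its sum $f$ satisfies $$\|f\|_{L^{\mathcal L}_{2,q,\alpha,2}}\le C\,\min\!\left(M,(1+\log M)^{|\alpha|+\varepsilon+1/q}\right)\|c\|_{l^{\mathcal R}_{2,q,\alpha,2}}.$$ Moreover, if $q<\infty$, the series converges to $f$ unconditionally in the quasi-norm of $L^{\mathcal L}_{2,q,\alpha,2}$; if $q=\infty$, the same holds provided that $(1+\log k)^\alpha\big(\sum_{i\ge k}(c_i^*)^2\big)^{1/2}\to0$ as $k\to\infty$. -/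

import Mathlib

open MeasureTheory Filter Topology
open scoped ENNReal NNReal

noncomputable section

namespace LimitingFourier

/-- Lebesgue measure on the unit interval `[0,1]`. -/
abbrev unitMeasure : Measure ℝ := volume.restrict (Set.Icc 0 1)

/-- The non-increasing rearrangement `f*(u) = inf {s ≥ 0 : |{x ∈ [0,1] : |f x| > s}| ≤ u}`
of a function on `[0,1]`. -/
def funRearr (f : ℝ → ℂ) (u : ℝ) : ℝ≥0∞ :=
  sInf {s : ℝ≥0∞ | unitMeasure {x | s < ‖f x‖ₑ} ≤ ENNReal.ofReal u}

/-- The non-increasing rearrangement of a family of complex numbers, numbered from `0`: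
`seqRearr c k` is `c*_{k+1} = inf {s ≥ 0 : #{i : |c i| > s} ≤ k}`. -/
def seqRearr {ι : Type*} (c : ι → ℂ) (k : ℕ) : ℝ≥0∞ :=
  sInf {s : ℝ≥0∞ | {i | s < ‖c i‖ₑ}.encard ≤ (k : ℕ∞)}

/-- The weight `t^{-1/q} (1 + |log t|)^α` for `t > 0`, where `1/∞ = 0`. -/
def weight (q : ℝ≥0∞) (α t : ℝ) : ℝ≥0∞ :=
  ENNReal.ofReal (t ^ (-(q⁻¹).toReal) * (1 + |Real.log t|) ^ α)

/-- The quasi-norm of `L^L_{2,q,α,2}`, that is, the `L_q(0,1)` quasi-norm of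
`t ↦ t^{-1/q} (1 + |log t|)^α (∫_0^t f*(u)^2 du)^{1/2}`. -/
def normLL (q : ℝ≥0∞) (α : ℝ) (f : ℝ → ℂ) : ℝ≥0∞ :=
  eLpNorm
    (fun t : ℝ => weight q α t * (∫⁻ u in Set.Ioo 0 t, funRearr f u ^ 2) ^ (1 / 2 : ℝ))
    q (volume.restrict (Set.Ioo 0 1))

/-- With `m = k + 1`, the number
`m^{-1/q} (1 + log m)^α (∑_{i ≥ m} (c*_i)^2)^{1/2}`. -/
def tailTerm {ι : Type*} (q : ℝ≥0∞) (α : ℝ) (c : ι → ℂ) (k : ℕ) : ℝ≥0∞ :=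
  weight q α ((k : ℝ) + 1) * (∑' i : ℕ, seqRearr c (k + i) ^ 2) ^ (1 / 2 : ℝ)

/-- The quasi-norm of `l^R_{2,q,α,2}`, that is, the `l_q` quasi-norm of
`m ↦ m^{-1/q} (1 + log m)^α (∑_{i ≥ m} (c*_i)^2)^{1/2}`, `m = 1, 2, …`. -/
def normlR {ι : Type*} (q : ℝ≥0∞) (α : ℝ) (c : ι → ℂ) : ℝ≥0∞ :=
  eLpNorm (tailTerm q α c) q Measure.count

end LimitingFourier

end

/-! For each `k`, split off the `k` largest coefficients. By the uniform bound on the system, that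
part of the sum is bounded by `M ∑_{j ≤ k} c*_j`, so it adds at most `M t^{1/2} ∑_{j ≤ k} c*_j` to
`(∫_0^t f*(u)^2 du)^{1/2}`; by Bessel's inequality the rest adds at most the `l_2` norm of the tail
of `c*`. Taking `k = 2^m - 1` and `t = 2^{-(m + l)}` with `2^{l/2} ≥ M` makes the powers of `2`
absorb `M`, and the weighted `l_q` norms over `m` are compared by a discrete Hardy inequality. The
shift by `l ∼ 1 + log M` costs `(1 + l)^{|α|}` in the weights, and the `l` scales `t > 2^{-l}`,
where only `‖f‖_2 ≤ ‖c‖_2` is used, cost a further `(1 + l)^{1/q}`. The convergence statements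
follow by applying the inequality to the remainders, whose norms tend to `0` by dominated
convergence. -/

namespace LimitingFourier

open Finset.HasAntidiagonal (antidiagonal mem_antidiagonal)

/-! ### Rearrangements of functions -/

section LayerCake

variable {X Y : Type*} [MeasurableSpace X] [MeasurableSpace Y] {μ : Measure X} {ν : Measure Y}
  [SFinite μ] [SFinite ν]

theorem volume_restrict_Ioi_zero_ofReal_lt (y : ℝ≥0∞) :
    volume.restrict (Set.Ioi 0) {s : ℝ | ENNReal.ofReal s < y} = y := by
  rw [Measure.restrict_apply (measurableSet_lt (by fun_prop) measurable_const)]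
  induction y with
  | top => simp
  | coe y =>
    have h : {s : ℝ | ENNReal.ofReal s < y} ∩ Set.Ioi 0 = Set.Ioo 0 (y : ℝ) := by
      ext s
      rw [Set.mem_inter_iff, and_comm]
      refine and_congr_right fun hs => ?_
      rw [Set.mem_ofPred_eq, ← ENNReal.ofReal_coe_nnreal,
        ENNReal.ofReal_lt_ofReal_iff_of_nonneg (le_of_lt hs)]
    simp [h]

theorem lintegral_eq_lintegral_Ioi_meas_lt {f : X → ℝ≥0∞} (hf : AEMeasurable f μ) :
    ∫⁻ x, f x ∂μ = ∫⁻ s in Set.Ioi (0 : ℝ), μ {x | ENNReal.ofReal s < f x} := by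
  have hS : MeasurableSet {p : X × ℝ | ENNReal.ofReal p.2 < hf.mk f p.1} :=
    measurableSet_lt (by fun_prop) (hf.measurable_mk.comp measurable_fst)
  calc ∫⁻ x, f x ∂μ
      = ∫⁻ x, volume.restrict (Set.Ioi 0) {s : ℝ | ENNReal.ofReal s < hf.mk f x} ∂μ := by
        simp only [volume_restrict_Ioi_zero_ofReal_lt]
        exact lintegral_congr_ae hf.ae_eq_mk
    _ = ∫⁻ s in Set.Ioi (0 : ℝ), μ {x | ENNReal.ofReal s < hf.mk f x} :=
        (Measure.prod_apply hS).symm.trans (Measure.prod_apply_symm hS)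
    _ = ∫⁻ s in Set.Ioi (0 : ℝ), μ {x | ENNReal.ofReal s < f x} :=
        lintegral_congr fun s => measure_congr
          (hf.ae_eq_mk.mono fun x hx => congrArg (ENNReal.ofReal s < ·) hx.symm)

theorem lintegral_le_lintegral_of_meas_lt_le {f : X → ℝ≥0∞} {g : Y → ℝ≥0∞}
    (hf : AEMeasurable f μ) (hg : AEMeasurable g ν)
    (h : ∀ s : ℝ≥0∞, μ {x | s < f x} ≤ ν {y | s < g y}) :
    ∫⁻ x, f x ∂μ ≤ ∫⁻ y, g y ∂ν := by
  rw [lintegral_eq_lintegral_Ioi_meas_lt hf, lintegral_eq_lintegral_Ioi_meas_lt hg]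
  exact lintegral_mono fun s => h _

theorem eLpNorm_le_eLpNorm_of_meas_lt_le {E F : Type*} [TopologicalSpace E] [ContinuousENorm E]
    [TopologicalSpace F] [ContinuousENorm F] {f : X → E} {g : Y → F}
    (hf : AEStronglyMeasurable f μ) (hg : AEStronglyMeasurable g ν)
    (h : ∀ s : ℝ≥0∞, μ {x | s < ‖f x‖ₑ} ≤ ν {y | s < ‖g y‖ₑ}) (p : ℝ≥0∞) :
    eLpNorm f p μ ≤ eLpNorm g p ν := by
  rcases eq_or_ne p 0 with rfl | hp0
  · simp
  rcases eq_or_ne p ∞ with rfl | hp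
  · simp only [eLpNorm_exponent_top, eLpNormEssSup, essSup_eq_sInf]
    exact sInf_le_sInf fun s hs => le_antisymm ((h s).trans_eq hs) zero_le
  · have hp' := ENNReal.toReal_pos hp0 hp
    rw [eLpNorm_eq_lintegral_rpow_enorm_toReal hp0 hp,
      eLpNorm_eq_lintegral_rpow_enorm_toReal hp0 hp]
    gcongr 1
    refine lintegral_le_lintegral_of_meas_lt_le (hf.enorm.pow_const _) (hg.enorm.pow_const _)
      fun s => ?_
    simpa only [ENNReal.rpow_inv_lt_iff hp'] using h (s ^ p.toReal⁻¹)

end LayerCake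

theorem antitone_funRearr (f : ℝ → ℂ) : Antitone (funRearr f) := fun _ _ huv =>
  sInf_le_sInf fun _ hs => le_trans hs (ENNReal.ofReal_le_ofReal huv)

theorem funRearr_le_add {f h : ℝ → ℂ} {B : ℝ≥0∞}
    (hfh : ∀ᵐ x ∂unitMeasure, ‖f x‖ₑ ≤ B + ‖h x‖ₑ) (u : ℝ) :
    funRearr f u ≤ B + funRearr h u := by
  rw [← tsub_le_iff_left]
  refine le_sInf fun s hs => tsub_le_iff_left.2 (sInf_le ((measure_mono_ae ?_).trans hs))
  filter_upwards [hfh] with x hx (hx' : B + s < ‖f x‖ₑ)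
  exact lt_of_add_lt_add_left (hx'.trans_le hx)

theorem volume_restrict_Ioo_lt_funRearr_le (f : ℝ → ℂ) (t : ℝ) (s : ℝ≥0∞) :
    volume.restrict (Set.Ioo 0 t) {u | s < funRearr f u} ≤ unitMeasure {x | s < ‖f x‖ₑ} := by
  rw [Measure.restrict_apply (measurableSet_lt measurable_const (antitone_funRearr f).measurable)]
  have hfin : unitMeasure {x | s < ‖f x‖ₑ} ≠ ∞ := measure_ne_top _ _
  have hsub : {u | s < funRearr f u} ∩ Set.Ioo 0 t ⊆
      Set.Ioo 0 (unitMeasure {x | s < ‖f x‖ₑ}).toReal := by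
    rintro u ⟨hu : s < funRearr f u, hu0, -⟩
    refine ⟨hu0, lt_of_not_ge fun hle => hu.not_ge (sInf_le ?_)⟩
    exact (ENNReal.le_ofReal_iff_toReal_le hfin hu0.le).2 hle
  calc volume ({u | s < funRearr f u} ∩ Set.Ioo 0 t)
      ≤ volume (Set.Ioo 0 (unitMeasure {x | s < ‖f x‖ₑ}).toReal) := measure_mono hsub
    _ = unitMeasure {x | s < ‖f x‖ₑ} := by
      rw [Real.volume_Ioo, sub_zero, ENNReal.ofReal_toReal hfin]

theorem eLpNorm_funRearr_le {f : ℝ → ℂ} (hf : AEStronglyMeasurable f unitMeasure) (p : ℝ≥0∞)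
    (t : ℝ) : eLpNorm (funRearr f) p (volume.restrict (Set.Ioo 0 t)) ≤ eLpNorm f p unitMeasure :=
  eLpNorm_le_eLpNorm_of_meas_lt_le (antitone_funRearr f).measurable.aestronglyMeasurable hf
    (volume_restrict_Ioo_lt_funRearr_le f t) p

theorem eLpNorm_two_eq_lintegral_sq {X : Type*} [MeasurableSpace X] (μ : Measure X)
    (f : X → ℝ≥0∞) : eLpNorm f 2 μ = (∫⁻ x, f x ^ 2 ∂μ) ^ (1 / 2 : ℝ) := by
  simp [eLpNorm_eq_lintegral_rpow_enorm_toReal two_ne_zero ENNReal.ofNat_ne_top]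

/-- The square root `(∫_0^t f*(u)^2 du)^{1/2}` of the head of the rearrangement, the quantity that
`normLL` averages over `t`. -/
noncomputable def funHead (f : ℝ → ℂ) (t : ℝ) : ℝ≥0∞ :=
  eLpNorm (funRearr f) 2 (volume.restrict (Set.Ioo 0 t))

theorem normLL_eq_eLpNorm_weight_mul_funHead (q : ℝ≥0∞) (α : ℝ) (f : ℝ → ℂ) :
    normLL q α f =
      eLpNorm (fun t => weight q α t * funHead f t) q (volume.restrict (Set.Ioo 0 1)) := by
  simp only [normLL, funHead, eLpNorm_two_eq_lintegral_sq]

theorem monotone_funHead (f : ℝ → ℂ) : Monotone (funHead f) := fun _ _ hst =>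
  eLpNorm_mono_measure _ (Measure.restrict_mono_set _ (Set.Ioo_subset_Ioo_right hst))

theorem funHead_le_add_eLpNorm {f h : ℝ → ℂ} {B : ℝ≥0∞}
    (hh : AEStronglyMeasurable h unitMeasure)
    (hfh : ∀ᵐ x ∂unitMeasure, ‖f x‖ₑ ≤ B + ‖h x‖ₑ) (t : ℝ) :
    funHead f t ≤ B * ENNReal.ofReal t ^ (1 / 2 : ℝ) + eLpNorm h 2 unitMeasure :=
  calc funHead f t
      ≤ eLpNorm ((fun _ => B) + funRearr h) 2 (volume.restrict (Set.Ioo 0 t)) :=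
        eLpNorm_mono_enorm fun u => funRearr_le_add hfh u
    _ ≤ eLpNorm (fun _ => B) 2 (volume.restrict (Set.Ioo 0 t)) +
        eLpNorm (funRearr h) 2 (volume.restrict (Set.Ioo 0 t)) :=
        eLpNorm_add_le aestronglyMeasurable_const
          (antitone_funRearr h).measurable.aestronglyMeasurable one_le_two
    _ ≤ B * ENNReal.ofReal t ^ (1 / 2 : ℝ) + eLpNorm h 2 unitMeasure := by
        gcongr
        · simp [eLpNorm_const' B two_ne_zero ENNReal.ofNat_ne_top]
        · exact eLpNorm_funRearr_le hh 2 t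

/-! ### Rearrangements of families -/

/-- The square root `(∑_{i ≥ k} x_i^2)^{1/2}` of the tail of a sequence, which `tailTerm` weights
with `x` the rearrangement of a family. -/
noncomputable def l2Tail (x : ℕ → ℝ≥0∞) (k : ℕ) : ℝ≥0∞ :=
  eLpNorm (fun i => x (k + i)) 2 Measure.count

theorem l2Tail_eq_tsum_rpow (x : ℕ → ℝ≥0∞) (k : ℕ) :
    l2Tail x k = (∑' i, x (k + i) ^ 2) ^ (1 / 2 : ℝ) := by
  rw [l2Tail, eLpNorm_two_eq_lintegral_sq, lintegral_count]

theorem l2Tail_sq (x : ℕ → ℝ≥0∞) (k : ℕ) : l2Tail x k ^ 2 = ∑' i, x (k + i) ^ 2 := by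
  rw [l2Tail_eq_tsum_rpow, ← ENNReal.rpow_natCast, ← ENNReal.rpow_mul]
  norm_num

theorem antitone_l2Tail (x : ℕ → ℝ≥0∞) : Antitone (l2Tail x) := by
  intro k l hkl
  rw [← ENNReal.pow_le_pow_left_iff two_ne_zero, l2Tail_sq, l2Tail_sq]
  calc ∑' i, x (l + i) ^ 2 = ∑' i, x (k + (l - k + i)) ^ 2 := by
        simp only [← add_assoc, Nat.add_sub_cancel' hkl]
    _ ≤ ∑' i, x (k + i) ^ 2 := ENNReal.tsum_comp_le_tsum_of_injective
        (add_right_injective (l - k)) fun i => x (k + i) ^ 2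

section Families

variable {ι : Type*} {c d : ι → ℂ}

theorem tailTerm_eq_weight_mul_l2Tail (q : ℝ≥0∞) (α : ℝ) (c : ι → ℂ) (k : ℕ) :
    tailTerm q α c k = weight q α (k + 1) * l2Tail (seqRearr c) k := by
  rw [tailTerm, l2Tail_eq_tsum_rpow]

theorem seqRearr_le_iSup (c : ι → ℂ) (k : ℕ) : seqRearr c k ≤ ⨆ i, ‖c i‖ₑ := by
  have hempty : {i | ⨆ j, ‖c j‖ₑ < ‖c i‖ₑ} = ∅ :=
    Set.eq_empty_of_forall_notMem fun i hi => (le_iSup (‖c ·‖ₑ) i).not_gt hi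
  exact sInf_le (by simp [hempty])

theorem seqRearr_mono (h : ∀ i, ‖d i‖ₑ ≤ ‖c i‖ₑ) (k : ℕ) : seqRearr d k ≤ seqRearr c k :=
  sInf_le_sInf fun _ hs => (Set.encard_le_encard fun i hi => lt_of_lt_of_le hi (h i)).trans hs

theorem tendsto_enorm_cofinite_of_l2Tail_ne_top (hc : l2Tail (seqRearr c) 0 ≠ ∞) :
    Tendsto (‖c ·‖ₑ) cofinite (𝓝 0) := by
  have hsum : ∑' k, seqRearr c k ^ 2 ≠ ∞ := by
    simpa only [l2Tail_sq, zero_add] using ENNReal.pow_ne_top (n := 2) hc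
  rw [ENNReal.tendsto_nhds_zero]
  intro s hs
  obtain ⟨k, hk⟩ := ((ENNReal.tendsto_atTop_zero_of_tsum_ne_top hsum).eventually
    (gt_mem_nhds (ENNReal.pow_pos hs 2))).exists
  obtain ⟨r, hr, hrs⟩ := sInf_lt_iff.1 ((ENNReal.pow_lt_pow_left_iff two_ne_zero).1 hk)
  have hfin : {i | r < ‖c i‖ₑ}.Finite := Set.finite_of_encard_le_coe hr
  exact eventually_cofinite.2 (hfin.subset fun i hi => hrs.trans (not_le.1 hi))

theorem injOn_ncard_setOf_lt {β : Type*} [LinearOrder β] {r : ι → β} (hr : r.Injective) {s : Set ι}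
    (hs : ∀ i ∈ s, {j | r j < r i}.Finite) : Set.InjOn (fun i => {j | r j < r i}.ncard) s := by
  have hlt : ∀ i j, j ∈ s → r i < r j → {l | r l < r i}.ncard < {l | r l < r j}.ncard :=
    fun i j hj hij => Set.ncard_lt_ncard
      ⟨fun l hl => lt_trans hl hij, fun h => lt_irrefl (r i) (h hij)⟩ (hs j hj)
  intro i hi j hj hij
  rcases lt_trichotomy (r i) (r j) with h | h | h
  · exact absurd hij (hlt i j hj h).ne
  · exact hr h
  · exact absurd hij (hlt j i hi h).ne'

theorem exists_injOn_le_seqRearr (hc : Tendsto (‖c ·‖ₑ) cofinite (𝓝 0)) :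
    ∃ σ : ι → ℕ, Set.InjOn σ {i | c i ≠ 0} ∧ ∀ i, c i ≠ 0 → ‖c i‖ₑ ≤ seqRearr c (σ i) := by
  let _ : LinearOrder ι := IsWellOrder.linearOrder WellOrderingRel
  -- decreasing modulus, ties broken by an arbitrary linear order
  let key : ι → (ℝ≥0∞)ᵒᵈ ×ₗ ι := fun i => toLex (OrderDual.toDual ‖c i‖ₑ, i)
  have hkey : key.Injective := fun i j hij => congrArg (fun p => (ofLex p).2) hij
  have henorm : ∀ {i j}, key j < key i → ‖c i‖ₑ ≤ ‖c j‖ₑ := fun {i j} hij =>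
    OrderDual.toDual_le_toDual.1 (Prod.Lex.monotone_fst _ _ hij.le)
  have hfin : ∀ i, c i ≠ 0 → {j | key j < key i}.Finite := fun i hi =>
    (eventually_cofinite.1 (hc.eventually (gt_mem_nhds (enorm_pos.2 hi)))).subset
      fun j hj => not_lt.2 (henorm hj)
  refine ⟨fun i => {j | key j < key i}.ncard, injOn_ncard_setOf_lt hkey hfin,
    fun i hi => le_sInf fun s hs => le_of_not_gt fun hsi => ?_⟩
  have hsub : insert i {j | key j < key i} ⊆ {j | s < ‖c j‖ₑ} :=
    Set.insert_subset hsi fun j hj => hsi.trans_le (henorm hj)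
  have hself : i ∉ {j | key j < key i} := lt_irrefl (key i)
  have hcard := (Set.encard_le_encard hsub).trans hs
  rw [Set.encard_insert_of_notMem hself, ← (hfin i hi).cast_ncard_eq] at hcard
  have : {j | key j < key i}.ncard + 1 ≤ {j | key j < key i}.ncard := by exact_mod_cast hcard
  omega

theorem exists_finset_sum_le_and_tsum_compl_le (hc : Tendsto (‖c ·‖ₑ) cofinite (𝓝 0)) (k : ℕ) :
    ∃ S : Finset ι, ∑ i ∈ S, ‖c i‖ₑ ≤ ∑ j ∈ Finset.range k, seqRearr c j ∧
      ∑' i, ‖(S : Set ι)ᶜ.indicator c i‖ₑ ^ 2 ≤ l2Tail (seqRearr c) k ^ 2 := by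
  classical
  obtain ⟨σ, hinj, hσ⟩ := exists_injOn_le_seqRearr hc
  have hfin : {i | c i ≠ 0 ∧ σ i < k}.Finite :=
    .of_finite_image ((Set.finite_lt_nat k).subset (Set.image_subset_iff.2 fun i hi => hi.2))
      (hinj.mono fun i hi => hi.1)
  have hS : ∀ {i}, i ∈ hfin.toFinset ↔ c i ≠ 0 ∧ σ i < k := hfin.mem_toFinset
  refine ⟨hfin.toFinset, ?_, ?_⟩
  · calc ∑ i ∈ hfin.toFinset, ‖c i‖ₑ ≤ ∑ i ∈ hfin.toFinset, seqRearr c (σ i) :=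
          Finset.sum_le_sum fun i hi => hσ i (hS.1 hi).1
      _ = ∑ j ∈ hfin.toFinset.image σ, seqRearr c j :=
          (Finset.sum_image fun i hi j hj => hinj (hS.1 hi).1 (hS.1 hj).1).symm
      _ ≤ ∑ j ∈ Finset.range k, seqRearr c j :=
          Finset.sum_le_sum_of_subset (Finset.image_subset_iff.2 fun i hi =>
            Finset.mem_range.2 (hS.1 hi).2)
  · set T : Set ι := {i | c i ≠ 0 ∧ k ≤ σ i}
    have hT : Function.Injective fun i : T => σ i - k := fun i j hij =>
      Subtype.ext (hinj i.2.1 j.2.1 (by have := i.2.2; have := j.2.2; grind))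
    have hsupp : ∀ i, ‖(hfin.toFinset : Set ι)ᶜ.indicator c i‖ₑ ^ 2 =
        T.indicator (fun i => ‖c i‖ₑ ^ 2) i := by
      intro i
      by_cases h0 : c i = 0 <;> by_cases hk : σ i < k <;> simp [Set.indicator, T, h0, hk]
    calc ∑' i, ‖(hfin.toFinset : Set ι)ᶜ.indicator c i‖ₑ ^ 2 = ∑' i : T, ‖c i‖ₑ ^ 2 := by
          rw [tsum_congr hsupp, tsum_subtype T fun i => ‖c i‖ₑ ^ 2]
      _ ≤ ∑' i : T, seqRearr c (k + (σ i - k)) ^ 2 := by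
          refine ENNReal.tsum_le_tsum fun i => ?_
          rw [Nat.add_sub_cancel' i.2.2]
          gcongr
          exact hσ i i.2.1
      _ ≤ ∑' j, seqRearr c (k + j) ^ 2 :=
          ENNReal.tsum_comp_le_tsum_of_injective hT fun j => seqRearr c (k + j) ^ 2
      _ = l2Tail (seqRearr c) k ^ 2 := (l2Tail_sq _ k).symm

theorem tsum_enorm_sq_le_l2Tail_sq (hc : l2Tail (seqRearr c) 0 ≠ ∞) :
    ∑' i, ‖c i‖ₑ ^ 2 ≤ l2Tail (seqRearr c) 0 ^ 2 := by
  obtain ⟨S, hS, hSc⟩ :=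
    exists_finset_sum_le_and_tsum_compl_le (tendsto_enorm_cofinite_of_l2Tail_ne_top hc) 0
  have hzero : ∀ i ∈ S, c i = 0 := by simpa using hS
  have hsupp : (S : Set ι)ᶜ.indicator c = c :=
    Set.indicator_eq_self.2 fun i hi hiS => hi (hzero i hiS)
  rwa [hsupp] at hSc

end Families

/-! ### Orthonormal series -/

section Orthonormal

variable {ι 𝕜 H : Type*} [RCLike 𝕜] [NormedAddCommGroup H] [InnerProductSpace 𝕜 H] {φ : ι → H}

theorem enorm_sq_sum_smul_of_orthonormal (hφ : Orthonormal 𝕜 φ) (c : ι → 𝕜) (F : Finset ι) :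
    ‖∑ n ∈ F, c n • φ n‖ₑ ^ 2 = ∑ n ∈ F, ‖c n‖ₑ ^ 2 := by
  have h := hφ.orthogonalFamily.norm_sum c F
  simp only [LinearIsometry.toSpanSingleton_apply] at h
  simp only [← ofReal_norm, ← ENNReal.ofReal_pow (norm_nonneg _)]
  rw [h, ENNReal.ofReal_sum_of_nonneg fun i _ => by positivity]

theorem enorm_sq_le_tsum_of_orthonormal (hφ : Orthonormal 𝕜 φ) {c : ι → 𝕜} {f : H}
    (hf : HasSum (fun n => c n • φ n) f) : ‖f‖ₑ ^ 2 ≤ ∑' n, ‖c n‖ₑ ^ 2 := by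
  have h : Tendsto (fun F : Finset ι => ‖∑ n ∈ F, c n • φ n‖ₑ ^ 2) atTop (𝓝 (‖f‖ₑ ^ 2)) :=
    (ENNReal.continuous_pow 2).tendsto _ |>.comp (hf.enorm)
  refine le_of_tendsto' h fun F => ?_
  rw [enorm_sq_sum_smul_of_orthonormal hφ]
  exact ENNReal.sum_le_tsum F

theorem summable_smul_of_orthonormal [CompleteSpace H] (hφ : Orthonormal 𝕜 φ) {c : ι → 𝕜}
    (hc : ∑' n, ‖c n‖ₑ ^ 2 ≠ ∞) : Summable fun n => c n • φ n := by
  have hsq : Summable fun n => ‖c n‖ ^ 2 :=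
    (ENNReal.summable_toReal hc).congr fun n => by simp
  simpa only [LinearIsometry.toSpanSingleton_apply] using
    (hφ.orthogonalFamily.summable_iff_norm_sq_summable c).2 hsq

end Orthonormal

theorem hasSum_indicator_compl_smul {ι R E : Type*} [Semiring R] [AddCommGroup E] [Module R E]
    [TopologicalSpace E] [IsTopologicalAddGroup E] {c : ι → R} {φ : ι → E} {f : E}
    (hf : HasSum (fun n => c n • φ n) f) (F : Finset ι) :
    HasSum (fun n => (F : Set ι)ᶜ.indicator c n • φ n) (f - ∑ n ∈ F, c n • φ n) := by
  simp only [← Set.indicator_smul_left]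
  rw [← hasSum_subtype_iff_indicator]
  exact (Finset.hasSum_compl_iff (f := fun n => c n • φ n) F).2 (by rwa [sub_add_cancel])

section BoundedSystem

variable {ι X 𝕜 E : Type*} [MeasurableSpace X] {μ : Measure X} [NormedField 𝕜]
  [NormedAddCommGroup E] [NormedSpace 𝕜 E] {p : ℝ≥0∞} {φ : ι → Lp E p μ}

theorem enorm_sum_smul_le_ae {M : ℝ≥0∞} (hM : ∀ n, eLpNorm (φ n) ∞ μ ≤ M) (c : ι → 𝕜)
    (S : Finset ι) :
    ∀ᵐ x ∂μ, ‖(∑ n ∈ S, c n • φ n : Lp E p μ) x‖ₑ ≤ M * ∑ n ∈ S, ‖c n‖ₑ := by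
  classical
  induction S using Finset.induction_on with
  | empty =>
    filter_upwards [Lp.coeFn_zero E p μ] with x hx
    rw [Finset.sum_empty, hx]
    simp
  | insert a S ha ih =>
    rw [Finset.sum_insert ha, Finset.sum_insert ha]
    filter_upwards [ih, Lp.coeFn_add (c a • φ a) (∑ n ∈ S, c n • φ n), Lp.coeFn_smul (c a) (φ a),
      enorm_ae_le_eLpNormEssSup (φ a) μ] with x hS hadd hsmul hess
    rw [hadd, Pi.add_apply, hsmul, Pi.smul_apply]
    calc ‖c a • φ a x + (∑ n ∈ S, c n • φ n : Lp E p μ) x‖ₑ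
        ≤ ‖c a‖ₑ * ‖φ a x‖ₑ + ‖(∑ n ∈ S, c n • φ n : Lp E p μ) x‖ₑ := by
          rw [← enorm_smul]; exact enorm_add_le _ _
      _ ≤ ‖c a‖ₑ * M + M * ∑ n ∈ S, ‖c n‖ₑ := by
          gcongr
          exact hess.trans (hM a)
      _ = M * (‖c a‖ₑ + ∑ n ∈ S, ‖c n‖ₑ) := by ring

end BoundedSystem

theorem one_le_iSup_eLpNorm_top {ι X 𝕜 E : Type*} [Nonempty ι] [MeasurableSpace X] {μ : Measure X}
    [IsProbabilityMeasure μ] [RCLike 𝕜] [NormedAddCommGroup E] [InnerProductSpace 𝕜 E]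
    {φ : ι → Lp E 2 μ} (hφ : Orthonormal 𝕜 φ) : 1 ≤ ⨆ n, eLpNorm (φ n) ∞ μ := by
  obtain ⟨n⟩ := ‹Nonempty ι›
  calc 1 = eLpNorm (φ n) 2 μ := by rw [← Lp.enorm_def, ← ofReal_norm, hφ.1 n, ENNReal.ofReal_one]
    _ ≤ eLpNorm (φ n) ∞ μ :=
      eLpNorm_le_eLpNorm_of_exponent_le le_top (Lp.aestronglyMeasurable _)
    _ ≤ ⨆ n, eLpNorm (φ n) ∞ μ := le_iSup (fun n => eLpNorm (φ n) ∞ μ) n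

section HeadTail

variable {ι : Type*} {φ : ι → Lp ℂ 2 unitMeasure} {c : ι → ℂ} {f : Lp ℂ 2 unitMeasure} {M : ℝ≥0∞}

theorem funHead_le_head_add_l2Tail (hφ : Orthonormal ℂ φ)
    (hM : ∀ n, eLpNorm (φ n) ∞ unitMeasure ≤ M) (hc : l2Tail (seqRearr c) 0 ≠ ∞)
    (hf : HasSum (fun n => c n • φ n) f) (k : ℕ) (t : ℝ) :
    funHead f t ≤ M * (∑ j ∈ Finset.range k, seqRearr c j) * ENNReal.ofReal t ^ (1 / 2 : ℝ) +
      l2Tail (seqRearr c) k := by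
  obtain ⟨S, hS, hSc⟩ :=
    exists_finset_sum_le_and_tsum_compl_le (tendsto_enorm_cofinite_of_l2Tail_ne_top hc) k
  set g : Lp ℂ 2 unitMeasure := ∑ n ∈ S, c n • φ n
  have htail : ‖f - g‖ₑ ≤ l2Tail (seqRearr c) k :=
    (ENNReal.pow_le_pow_left_iff two_ne_zero).1
      ((enorm_sq_le_tsum_of_orthonormal hφ (hasSum_indicator_compl_smul hf S)).trans hSc)
  have hae : ∀ᵐ x ∂unitMeasure, ‖f x‖ₑ ≤ M * ∑ n ∈ S, ‖c n‖ₑ + ‖(f - g) x‖ₑ := by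
    filter_upwards [enorm_sum_smul_le_ae hM c S, Lp.coeFn_sub f g] with x hg hsub
    calc ‖f x‖ₑ = ‖g x + (f - g) x‖ₑ := by rw [hsub, Pi.sub_apply, add_sub_cancel]
      _ ≤ M * ∑ n ∈ S, ‖c n‖ₑ + ‖(f - g) x‖ₑ := (enorm_add_le _ _).trans (by gcongr)
  calc funHead f t
      ≤ M * (∑ n ∈ S, ‖c n‖ₑ) * ENNReal.ofReal t ^ (1 / 2 : ℝ) + ‖f - g‖ₑ :=
        Lp.enorm_def (f - g) ▸ funHead_le_add_eLpNorm (Lp.aestronglyMeasurable (f - g)) hae t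
    _ ≤ M * (∑ j ∈ Finset.range k, seqRearr c j) * ENNReal.ofReal t ^ (1 / 2 : ℝ) +
        l2Tail (seqRearr c) k := by gcongr

theorem funHead_le_l2Tail_zero (hφ : Orthonormal ℂ φ)
    (hM : ∀ n, eLpNorm (φ n) ∞ unitMeasure ≤ M) (hc : l2Tail (seqRearr c) 0 ≠ ∞)
    (hf : HasSum (fun n => c n • φ n) f) (t : ℝ) : funHead f t ≤ l2Tail (seqRearr c) 0 := by
  simpa using funHead_le_head_add_l2Tail hφ hM hc hf 0 t

theorem two_rpow_mul_two_rpow (x y : ℝ) : (2 : ℝ≥0∞) ^ x * 2 ^ y = 2 ^ (x + y) :=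
  (ENNReal.rpow_add x y two_ne_zero ENNReal.ofNat_ne_top).symm

theorem sum_range_sub_one_two_pow_le (x : ℕ → ℝ≥0∞) (J : ℕ) :
    ∑ j ∈ Finset.range (2 ^ J - 1), x j ≤
      ∑ j ∈ Finset.range J, (2 : ℝ≥0∞) ^ ((j : ℝ) / 2) * l2Tail x (2 ^ j - 1) := by
  induction J with
  | zero => simp
  | succ J ih =>
    have hsplit : 2 ^ (J + 1) - 1 = (2 ^ J - 1) + 2 ^ J := by
      have := Nat.one_le_two_pow (n := J)
      omega
    rw [hsplit, Finset.sum_range_add, Finset.sum_range_succ _ J]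
    refine add_le_add ih ((ENNReal.pow_le_pow_left_iff two_ne_zero).1 ?_)
    have hpow : ((2 : ℝ≥0∞) ^ ((J : ℝ) / 2)) ^ 2 = 2 ^ J := by
      rw [sq, two_rpow_mul_two_rpow, add_halves, ENNReal.rpow_natCast]
    calc (∑ i ∈ Finset.range (2 ^ J), x (2 ^ J - 1 + i)) ^ 2
        ≤ 2 ^ J * ∑ i ∈ Finset.range (2 ^ J), x (2 ^ J - 1 + i) ^ 2 := by
          simpa [show (2 : ℝ) - 1 = 1 by norm_num] using
            ENNReal.rpow_sum_le_const_mul_sum_rpow (Finset.range (2 ^ J))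
              (fun i => x (2 ^ J - 1 + i)) one_le_two
      _ ≤ 2 ^ J * l2Tail x (2 ^ J - 1) ^ 2 := by
          rw [l2Tail_sq]
          gcongr
          exact ENNReal.sum_le_tsum _
      _ = ((2 : ℝ≥0∞) ^ ((J : ℝ) / 2) * l2Tail x (2 ^ J - 1)) ^ 2 := by rw [mul_pow, hpow]

theorem ofReal_two_inv_pow_rpow_half (n : ℕ) :
    ENNReal.ofReal ((2 : ℝ)⁻¹ ^ n) ^ (1 / 2 : ℝ) = (2 : ℝ≥0∞) ^ (-(n : ℝ) * (1 / 2)) := by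
  rw [ENNReal.ofReal_pow (by norm_num), ENNReal.ofReal_inv_of_pos (by norm_num),
    ENNReal.ofReal_ofNat, ← ENNReal.rpow_neg_one, ← ENNReal.rpow_natCast, ← ENNReal.rpow_mul,
    ← ENNReal.rpow_mul]
  ring_nf

theorem funHead_two_inv_pow_add_le (hφ : Orthonormal ℂ φ)
    (hM : ∀ n, eLpNorm (φ n) ∞ unitMeasure ≤ M) (hc : l2Tail (seqRearr c) 0 ≠ ∞)
    (hf : HasSum (fun n => c n • φ n) f) {l : ℕ} (hl : M ≤ (2 : ℝ≥0∞) ^ ((l : ℝ) / 2)) (m : ℕ) :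
    funHead f ((2 : ℝ)⁻¹ ^ (m + l)) ≤ ∑ p ∈ antidiagonal m,
      (2 : ℝ≥0∞) ^ (-(p.2 : ℝ) * (1 / 2)) * l2Tail (seqRearr c) (2 ^ p.1 - 1) := by
  rw [Finset.Nat.sum_antidiagonal_eq_sum_range_succ
    fun j i => (2 : ℝ≥0∞) ^ (-(i : ℝ) * (1 / 2)) * l2Tail (seqRearr c) (2 ^ j - 1)]
  set a : ℕ → ℝ≥0∞ := fun j => l2Tail (seqRearr c) (2 ^ j - 1)
  calc funHead f ((2 : ℝ)⁻¹ ^ (m + l))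
      ≤ M * (∑ j ∈ Finset.range (2 ^ m - 1), seqRearr c j) * 2 ^ (-((m + l : ℕ) : ℝ) * (1 / 2)) +
          a m := by
        rw [← ofReal_two_inv_pow_rpow_half]
        exact funHead_le_head_add_l2Tail hφ hM hc hf (2 ^ m - 1) _
    _ ≤ 2 ^ ((l : ℝ) / 2) * (∑ j ∈ Finset.range m, (2 : ℝ≥0∞) ^ ((j : ℝ) / 2) * a j) *
          2 ^ (-((m + l : ℕ) : ℝ) * (1 / 2)) + a m := by
        gcongr
        exact sum_range_sub_one_two_pow_le (seqRearr c) m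
    _ = ∑ j ∈ Finset.range (m + 1), 2 ^ (-((m - j : ℕ) : ℝ) * (1 / 2)) * a j := by
        rw [Finset.sum_range_succ, Nat.sub_self, mul_right_comm, two_rpow_mul_two_rpow,
          Finset.mul_sum]
        congr 1
        · refine Finset.sum_congr rfl fun j hj => ?_
          rw [← mul_assoc, two_rpow_mul_two_rpow, Nat.cast_sub (Finset.mem_range.1 hj).le]
          push_cast
          ring_nf
        · simp

end HeadTail

/-! ### Discretization of quasi-norms -/

section LpSeminorm

variable {X κ : Type*} [MeasurableSpace X] {μ : Measure X} {q : ℝ≥0∞} {g : X → ℝ≥0∞}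
  {b : ℕ → ℝ≥0∞}

theorem eLpNorm_rpow_toReal (hq : q ≠ 0) (hq' : q ≠ ∞) (g : X → ℝ≥0∞) :
    eLpNorm g q μ ^ q.toReal = ∫⁻ x, g x ^ q.toReal ∂μ := by
  rw [eLpNorm_eq_lintegral_rpow_enorm_toReal hq hq', ← ENNReal.rpow_mul,
    one_div_mul_cancel (ENNReal.toReal_pos hq hq').ne', ENNReal.rpow_one]
  rfl

theorem eLpNorm_count_rpow_toReal [MeasurableSingletonClass X] (hq : q ≠ 0) (hq' : q ≠ ∞)
    (g : X → ℝ≥0∞) : eLpNorm g q Measure.count ^ q.toReal = ∑' x, g x ^ q.toReal := by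
  rw [eLpNorm_rpow_toReal hq hq', lintegral_count]

theorem eLpNorm_count_le_mul {C : ℝ≥0∞} {g h : ℕ → ℝ≥0∞} (hgh : ∀ n, g n ≤ C * h n) (q : ℝ≥0∞) :
    eLpNorm g q Measure.count ≤ C * eLpNorm h q Measure.count :=
  eLpNorm_le_mul_eLpNorm_of_ae_le_mul'' q (by fun_prop) (.of_forall hgh)

theorem toReal_inv_mul_toReal (hq : q ≠ 0) (hq' : q ≠ ∞) : (q⁻¹).toReal * q.toReal = 1 := by
  rw [ENNReal.toReal_inv, inv_mul_cancel₀ (ENNReal.toReal_pos hq hq').ne']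

theorem rpow_toReal_inv_mul_rpow_toReal (hq : q ≠ 0) (hq' : q ≠ ∞) (x y : ℝ≥0∞) :
    (x ^ (q⁻¹).toReal * y) ^ q.toReal = x * y ^ q.toReal := by
  rw [ENNReal.mul_rpow_of_nonneg _ _ ENNReal.toReal_nonneg, ← ENNReal.rpow_mul,
    toReal_inv_mul_toReal hq hq', ENNReal.rpow_one]

theorem eLpNorm_restrict_iUnion_le_eLpNorm_count {s : ℕ → Set X} (hq : q ≠ 0)
    (hs : ∀ n, MeasurableSet (s n)) (hμ : ∀ n, μ (s n) ≠ ∞)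
    (h : ∀ n, ∀ x ∈ s n, μ (s n) ^ (q⁻¹).toReal * g x ≤ b n) :
    eLpNorm g q (μ.restrict (⋃ n, s n)) ≤ eLpNorm b q Measure.count := by
  rcases eq_or_ne q ∞ with rfl | hq'
  · simp only [ENNReal.inv_top, ENNReal.toReal_zero, ENNReal.rpow_zero, one_mul] at h
    rw [eLpNorm_exponent_top, eLpNorm_exponent_top, eLpNormEssSup_count]
    refine eLpNormEssSup_le_of_ae_enorm_bound
      (ae_restrict_of_forall_mem (.iUnion hs) fun x hx => ?_)
    obtain ⟨n, hn⟩ := Set.mem_iUnion.1 hx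
    exact (h n x hn).trans (le_iSup b n)
  have hblock : ∀ n, ∫⁻ x in s n, g x ^ q.toReal ∂μ ≤ b n ^ q.toReal := by
    intro n
    rcases eq_or_ne (μ (s n)) 0 with h0 | h0
    · simp [setLIntegral_measure_zero _ _ h0]
    calc ∫⁻ x in s n, g x ^ q.toReal ∂μ ≤ ∫⁻ _ in s n, b n ^ q.toReal / μ (s n) ∂μ := by
          refine setLIntegral_mono measurable_const fun x hx => ?_
          rw [ENNReal.le_div_iff_mul_le (.inl h0) (.inl (hμ n)), mul_comm,
            ← rpow_toReal_inv_mul_rpow_toReal hq hq']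
          gcongr
          exact h n x hx
      _ = b n ^ q.toReal := by rw [setLIntegral_const, ENNReal.div_mul_cancel h0 (hμ n)]
  rw [← ENNReal.rpow_le_rpow_iff (ENNReal.toReal_pos hq hq'), eLpNorm_rpow_toReal hq hq',
    eLpNorm_count_rpow_toReal hq hq']
  exact (lintegral_iUnion_le s _).trans (ENNReal.tsum_le_tsum hblock)

theorem eLpNorm_count_le_eLpNorm_of_disjoint {s : ℕ → Set X} (hq : q ≠ 0)
    (hs : ∀ n, MeasurableSet (s n)) (hd : Pairwise (Function.onFun Disjoint s))
    (hμ0 : ∀ n, μ (s n) ≠ 0) (hμ : ∀ n, μ (s n) ≠ ∞)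
    (h : ∀ n, ∀ x ∈ s n, b n ≤ μ (s n) ^ (q⁻¹).toReal * g x) :
    eLpNorm b q Measure.count ≤ eLpNorm g q μ := by
  rcases eq_or_ne q ∞ with rfl | hq'
  · simp only [ENNReal.inv_top, ENNReal.toReal_zero, ENNReal.rpow_zero, one_mul] at h
    rw [eLpNorm_exponent_top, eLpNorm_exponent_top, eLpNormEssSup_count]
    refine iSup_le fun n => ?_
    obtain ⟨x, hx, hgx⟩ := ((frequently_ae_mem_iff.2 (hμ0 n)).and_eventually
      (enorm_ae_le_eLpNormEssSup g μ)).exists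
    exact (h n x hx).trans hgx
  have hblock : ∀ n, b n ^ q.toReal ≤ ∫⁻ x in s n, g x ^ q.toReal ∂μ := fun n =>
    calc b n ^ q.toReal = ∫⁻ _ in s n, b n ^ q.toReal / μ (s n) ∂μ := by
          rw [setLIntegral_const, ENNReal.div_mul_cancel (hμ0 n) (hμ n)]
      _ ≤ ∫⁻ x in s n, g x ^ q.toReal ∂μ := by
          refine setLIntegral_mono' (hs n) fun x hx => ENNReal.div_le_of_le_mul' ?_
          rw [← rpow_toReal_inv_mul_rpow_toReal hq hq']
          gcongr
          exact h n x hx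
  rw [← ENNReal.rpow_le_rpow_iff (ENNReal.toReal_pos hq hq'), eLpNorm_count_rpow_toReal hq hq',
    eLpNorm_rpow_toReal hq hq']
  calc ∑' n, b n ^ q.toReal ≤ ∑' n, ∫⁻ x in s n, g x ^ q.toReal ∂μ := ENNReal.tsum_le_tsum hblock
    _ = ∫⁻ x in ⋃ n, s n, g x ^ q.toReal ∂μ := (lintegral_iUnion hs hd _).symm
    _ ≤ ∫⁻ x, g x ^ q.toReal ∂μ := setLIntegral_le_lintegral _ _

theorem eLpNorm_count_le_of_eLpNorm_comp_add_le {A : ℝ≥0∞} {l : ℕ} (hq : q ≠ 0)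
    (hhead : ∀ n < l, b n ≤ A) (htail : eLpNorm (fun n => b (n + l)) q Measure.count ≤ A) :
    eLpNorm b q Measure.count ≤ (1 + l) ^ (q⁻¹).toReal * A := by
  rcases eq_or_ne q ∞ with rfl | hq'
  · simp only [ENNReal.inv_top, ENNReal.toReal_zero, ENNReal.rpow_zero, one_mul]
    rw [eLpNorm_exponent_top, eLpNormEssSup_count] at htail ⊢
    refine iSup_le fun n => ?_
    rcases lt_or_ge n l with hn | hn
    · exact hhead n hn
    · obtain ⟨m, rfl⟩ := Nat.exists_eq_add_of_le' hn
      exact (le_iSup (fun n => ‖b (n + l)‖ₑ) m).trans htail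
  have hq0 := ENNReal.toReal_pos hq hq'
  rw [← ENNReal.rpow_le_rpow_iff hq0, eLpNorm_count_rpow_toReal hq hq'] at htail ⊢
  rw [rpow_toReal_inv_mul_rpow_toReal hq hq']
  calc ∑' n, b n ^ q.toReal
      = ∑ n ∈ Finset.range l, b n ^ q.toReal + ∑' n, b (n + l) ^ q.toReal :=
        (ENNReal.summable.sum_add_tsum_nat_add' (f := fun n => b n ^ q.toReal)).symm
    _ ≤ ∑ _ ∈ Finset.range l, A ^ q.toReal + A ^ q.toReal := by
        gcongr with n hn
        exact hhead n (Finset.mem_range.1 hn)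
    _ = (1 + l) * A ^ q.toReal := by
        rw [Finset.sum_const, Finset.card_range, nsmul_eq_mul]
        ring

theorem tendsto_tsum_nhds_zero_of_dominated {L : Filter κ} {G : κ → ℕ → ℝ≥0∞}
    (hb : ∑' n, b n ≠ ∞) (hGb : ∀ i n, G i n ≤ b n) (hG : ∀ n, Tendsto (G · n) L (𝓝 0)) :
    Tendsto (fun i => ∑' n, G i n) L (𝓝 0) := by
  rw [ENNReal.tendsto_nhds_zero]
  intro ε hε
  obtain ⟨N, hN⟩ := (ENNReal.tendsto_nhds_zero.1 (ENNReal.tendsto_sum_nat_add b hb) (ε / 2)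
    (ENNReal.half_pos hε.ne')).exists
  have hhead : Tendsto (fun i => ∑ n ∈ Finset.range N, G i n) L (𝓝 0) := by
    simpa using tendsto_finsetSum (Finset.range N) fun n _ => hG n
  filter_upwards [ENNReal.tendsto_nhds_zero.1 hhead (ε / 2) (ENNReal.half_pos hε.ne')] with i hi
  calc ∑' n, G i n = ∑ n ∈ Finset.range N, G i n + ∑' n, G i (n + N) :=
        (ENNReal.summable.sum_add_tsum_nat_add' (f := G i)).symm
    _ ≤ ε / 2 + ∑' n, b (n + N) := add_le_add hi (ENNReal.tsum_le_tsum fun n => hGb i _)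
    _ ≤ ε := (add_le_add_right hN _).trans_eq (ENNReal.add_halves ε)

theorem tendsto_iSup_nhds_zero_of_dominated {L : Filter κ} {G : κ → ℕ → ℝ≥0∞}
    (hb : Tendsto b atTop (𝓝 0)) (hGb : ∀ i n, G i n ≤ b n)
    (hG : ∀ n, Tendsto (G · n) L (𝓝 0)) : Tendsto (fun i => ⨆ n, G i n) L (𝓝 0) := by
  rw [ENNReal.tendsto_nhds_zero]
  intro ε hε
  obtain ⟨N, hN⟩ := eventually_atTop.1 (ENNReal.tendsto_nhds_zero.1 hb ε hε)
  have hhead : ∀ᶠ i in L, ∀ n ∈ Finset.range N, G i n ≤ ε :=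
    (Finset.eventually_all _).2 fun n _ => ENNReal.tendsto_nhds_zero.1 (hG n) ε hε
  filter_upwards [hhead] with i hi
  refine iSup_le fun n => ?_
  rcases lt_or_ge n N with hn | hn
  · exact hi n (Finset.mem_range.2 hn)
  · exact (hGb i n).trans (hN n hn)

theorem tendsto_eLpNorm_count_nhds_zero_of_dominated {L : Filter κ} {G : κ → ℕ → ℝ≥0∞} (hq : q ≠ 0)
    (hb : eLpNorm b q Measure.count ≠ ∞) (hb' : q ≠ ∞ ∨ Tendsto b atTop (𝓝 0))
    (hGb : ∀ i n, G i n ≤ b n) (hG : ∀ n, Tendsto (G · n) L (𝓝 0)) :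
    Tendsto (fun i => eLpNorm (G i) q Measure.count) L (𝓝 0) := by
  rcases eq_or_ne q ∞ with rfl | hq'
  · simp only [eLpNorm_exponent_top, eLpNormEssSup_count, enorm_eq_self]
    exact tendsto_iSup_nhds_zero_of_dominated (hb'.resolve_left fun h => h rfl) hGb hG
  have hq0 := ENNReal.toReal_pos hq hq'
  have hsum : Tendsto (fun i => ∑' n, G i n ^ q.toReal) L (𝓝 0) := by
    refine tendsto_tsum_nhds_zero_of_dominated (b := fun n => b n ^ q.toReal) ?_
      (fun i n => by gcongr; exact hGb i n) fun n => ?_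
    · rw [← eLpNorm_count_rpow_toReal hq hq']
      exact ENNReal.rpow_ne_top_of_nonneg hq0.le hb
    · simpa [ENNReal.zero_rpow_of_pos hq0] using (hG n).ennrpow_const q.toReal
  have hroot := hsum.ennrpow_const q.toReal⁻¹
  simpa only [← eLpNorm_count_rpow_toReal hq hq', ← ENNReal.rpow_mul, mul_inv_cancel₀ hq0.ne',
    ENNReal.rpow_one, ENNReal.zero_rpow_of_pos (inv_pos.2 hq0)] using hroot

theorem sum_mul_le_tsum_mul_sup {α : Type*} (s : Finset α) {σ : α → ℕ} (hσ : Set.InjOn σ s)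
    (w : ℕ → ℝ≥0∞) (y : α → ℝ≥0∞) : ∑ i ∈ s, w (σ i) * y i ≤ (∑' n, w n) * s.sup y := by
  classical
  calc ∑ i ∈ s, w (σ i) * y i ≤ ∑ i ∈ s, w (σ i) * s.sup y := by
        gcongr with i hi
        exact Finset.le_sup hi
    _ = (∑ n ∈ s.image σ, w n) * s.sup y := by rw [Finset.sum_image hσ, Finset.sum_mul]
    _ ≤ (∑' n, w n) * s.sup y := by gcongr; exact ENNReal.sum_le_tsum _

theorem eLpNorm_sup_antidiagonal_mul_le (hq : q ≠ 0) (a z : ℕ → ℝ≥0∞) :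
    eLpNorm (fun m => (antidiagonal m).sup fun p => a p.1 * z p.2) q Measure.count ≤
      eLpNorm a q Measure.count * eLpNorm z q Measure.count := by
  rcases eq_or_ne q ∞ with rfl | hq'
  · simp only [eLpNorm_exponent_top, eLpNormEssSup_count, enorm_eq_self]
    exact iSup_le fun m => Finset.sup_le fun p _ => mul_le_mul' (le_iSup a _) (le_iSup z _)
  have hq0 := ENNReal.toReal_pos hq hq'
  rw [← ENNReal.rpow_le_rpow_iff hq0, ENNReal.mul_rpow_of_nonneg _ _ hq0.le]
  simp only [eLpNorm_count_rpow_toReal hq hq']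
  calc ∑' m, ((antidiagonal m).sup fun p => a p.1 * z p.2) ^ q.toReal
      ≤ ∑' m, ∑ p ∈ antidiagonal m, a p.1 ^ q.toReal * z p.2 ^ q.toReal := by
        refine ENNReal.tsum_le_tsum fun m => ?_
        obtain ⟨p, hp, hsup⟩ := (antidiagonal m).exists_mem_eq_sup
          ⟨(0, m), by simp⟩ fun p => a p.1 * z p.2
        rw [hsup, ENNReal.mul_rpow_of_nonneg _ _ hq0.le]
        exact Finset.single_le_sum (f := fun p => a p.1 ^ q.toReal * z p.2 ^ q.toReal)
          (fun _ _ => zero_le) hp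
    _ = ∑' p : ℕ × ℕ, a p.1 ^ q.toReal * z p.2 ^ q.toReal := by
        rw [← Finset.HasAntidiagonal.sigmaAntidiagonalEquivProd.tsum_eq, ENNReal.tsum_sigma']
        exact tsum_congr fun m => (Finset.tsum_subtype _ fun p : ℕ × ℕ =>
          a p.1 ^ q.toReal * z p.2 ^ q.toReal).symm
    _ = (∑' n, a n ^ q.toReal) * ∑' n, z n ^ q.toReal := by
        rw [ENNReal.tsum_prod']
        simp only [ENNReal.tsum_mul_left, ENNReal.tsum_mul_right]

theorem eLpNorm_sum_antidiagonal_mul_le (hq : q ≠ 0) (a z w : ℕ → ℝ≥0∞) :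
    eLpNorm (fun m => ∑ p ∈ antidiagonal m, w p.2 * (a p.1 * z p.2)) q Measure.count ≤
      (∑' n, w n) * (eLpNorm a q Measure.count * eLpNorm z q Measure.count) := by
  refine (eLpNorm_count_le_mul (fun m => sum_mul_le_tsum_mul_sup _ ?_ w _) q).trans
    (by gcongr; exact eLpNorm_sup_antidiagonal_mul_le hq a z)
  rintro p hp p' hp' (h : p.2 = p'.2)
  have := mem_antidiagonal.1 hp
  have := mem_antidiagonal.1 hp'
  ext <;> omega

end LpSeminorm

/-! ### Logarithmic weights at dyadic points -/

/-- The weight `(1 + n)^α`, comparable to `(1 + |log t|)^α` at `t = 2^{-n}` and at `t = 2^n`. -/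
noncomputable def logWeight (α : ℝ) (n : ℕ) : ℝ≥0∞ := ENNReal.ofReal ((1 + (n : ℝ)) ^ α)

theorem rpow_le_mul_rpow_of_comparable {x y K : ℝ} (hx : 0 < x) (hy : 0 < y) (hK : 0 < K)
    (hxy : x ≤ K * y) (hyx : y ≤ K * x) (α : ℝ) : x ^ α ≤ K ^ |α| * y ^ α := by
  rcases le_total 0 α with h | h
  · rw [abs_of_nonneg h, ← Real.mul_rpow hK.le hy.le]
    exact Real.rpow_le_rpow hx.le hxy h
  · rw [abs_of_nonpos h, Real.rpow_neg hK.le, ← div_eq_inv_mul, le_div_iff₀ (by positivity),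
      mul_comm, ← Real.mul_rpow hK.le hx.le]
    exact Real.rpow_le_rpow_of_nonpos hy hyx h

@[simp] theorem logWeight_zero (α : ℝ) : logWeight α 0 = 1 := by simp [logWeight]

theorem logWeight_add_le (α : ℝ) (m l : ℕ) :
    logWeight α (m + l) ≤ logWeight |α| l * logWeight α m := by
  rw [logWeight, logWeight, logWeight, ← ENNReal.ofReal_mul (by positivity)]
  refine ENNReal.ofReal_le_ofReal (rpow_le_mul_rpow_of_comparable (by positivity) (by positivity)
    (by positivity) ?_ ?_ α) <;> push_cast
  · linarith [show 0 ≤ (l : ℝ) * m by positivity]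
  · linarith [show 0 ≤ (l : ℝ) * (m + l) + 2 * l by positivity]

theorem logWeight_le_logWeight_abs {α : ℝ} {n l : ℕ} (h : n ≤ l) :
    logWeight α n ≤ logWeight |α| l := by
  refine ENNReal.ofReal_le_ofReal ?_
  calc (1 + (n : ℝ)) ^ α ≤ (1 + (n : ℝ)) ^ |α| :=
        Real.rpow_le_rpow_of_exponent_le (by simp) (le_abs_self α)
    _ ≤ (1 + (l : ℝ)) ^ |α| := by gcongr

theorem one_add_rpow_mul_logWeight {r : ℝ} (hr : 0 ≤ r) (β : ℝ) (l : ℕ) :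
    (1 + (l : ℝ≥0∞)) ^ r * logWeight β l = logWeight (β + r) l := by
  rw [logWeight, logWeight, add_comm β, Real.rpow_add (by positivity),
    ENNReal.ofReal_mul (by positivity), ← ENNReal.ofReal_rpow_of_nonneg (by positivity) hr,
    ENNReal.ofReal_add zero_le_one (by positivity), ENNReal.ofReal_one, ENNReal.ofReal_natCast]

theorem ofReal_two_rpow (x : ℝ) : ENNReal.ofReal ((2 : ℝ) ^ x) = (2 : ℝ≥0∞) ^ x := by
  rw [← ENNReal.ofReal_rpow_of_pos (by norm_num), ENNReal.ofReal_ofNat]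

theorem ofReal_one_add_abs_log_rpow_le (α : ℝ) {n : ℕ} {t : ℝ}
    (ht : t ∈ Set.Ioc ((2 : ℝ)⁻¹ ^ (n + 1)) ((2 : ℝ)⁻¹ ^ n)) :
    ENNReal.ofReal ((1 + |Real.log t|) ^ α) ≤ 2 ^ |α| * logWeight α n := by
  have ht0 : 0 < t := lt_trans (by positivity) ht.1
  have hlower : -((n + 1) * Real.log 2) ≤ Real.log t := by
    simpa [Real.log_pow] using Real.log_le_log (by positivity) ht.1.le
  have hupper : Real.log t ≤ -(n * Real.log 2) := by
    simpa [Real.log_pow] using Real.log_le_log ht0 ht.2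
  have hlog1 := Real.log_two_gt_d9
  have hlog2 := Real.log_two_lt_d9
  have habs : |Real.log t| = -Real.log t :=
    abs_of_nonpos (hupper.trans (neg_nonpos.2 (by positivity)))
  rw [logWeight, ← ofReal_two_rpow, ← ENNReal.ofReal_mul (by positivity), habs]
  refine ENNReal.ofReal_le_ofReal (rpow_le_mul_rpow_of_comparable ?_ (by positivity) two_pos
    ?_ ?_ α) <;> nlinarith [Nat.cast_nonneg (α := ℝ) n]

theorem rpow_mul_weight_le_of_mem_Ioc (q : ℝ≥0∞) (α : ℝ) {n : ℕ} {t : ℝ}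
    (ht : t ∈ Set.Ioc ((2 : ℝ)⁻¹ ^ (n + 1)) ((2 : ℝ)⁻¹ ^ n)) :
    ENNReal.ofReal ((2 : ℝ)⁻¹ ^ (n + 1)) ^ (q⁻¹).toReal * weight q α t ≤
      2 ^ |α| * logWeight α n := by
  have ht0 : 0 < t := lt_trans (by positivity) ht.1
  calc ENNReal.ofReal ((2 : ℝ)⁻¹ ^ (n + 1)) ^ (q⁻¹).toReal * weight q α t
      ≤ ENNReal.ofReal (t ^ (q⁻¹).toReal) * weight q α t := by
        rw [← ENNReal.ofReal_rpow_of_pos ht0]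
        gcongr
        exact ht.1.le
    _ = ENNReal.ofReal ((1 + |Real.log t|) ^ α) := by
        rw [weight, ← ENNReal.ofReal_mul (by positivity), ← mul_assoc, ← Real.rpow_add ht0,
          add_neg_cancel, Real.rpow_zero, one_mul]
    _ ≤ 2 ^ |α| * logWeight α n := ofReal_one_add_abs_log_rpow_le α ht

theorem logWeight_le_ofReal_one_add_abs_log_rpow (α : ℝ) {j k : ℕ} (h1 : 2 ^ j ≤ 2 * (k + 1))
    (h2 : k + 1 ≤ 2 ^ j) :
    logWeight α j ≤ 2 ^ |α| * ENNReal.ofReal ((1 + |Real.log ((k : ℝ) + 1)|) ^ α) := by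
  have hlower : j * Real.log 2 ≤ Real.log 2 + Real.log ((k : ℝ) + 1) := by
    rw [← Real.log_pow, ← Real.log_mul two_ne_zero (by positivity)]
    exact Real.log_le_log (by positivity) (by exact_mod_cast h1)
  have hupper : Real.log ((k : ℝ) + 1) ≤ j * Real.log 2 := by
    rw [← Real.log_pow]
    exact Real.log_le_log (by positivity) (by exact_mod_cast h2)
  have hlog1 := Real.log_two_gt_d9
  have hlog2 := Real.log_two_lt_d9
  have hlog0 : 0 ≤ Real.log ((k : ℝ) + 1) := Real.log_nonneg (by simp)
  rw [logWeight, ← ofReal_two_rpow, ← ENNReal.ofReal_mul (by positivity), abs_of_nonneg hlog0]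
  refine ENNReal.ofReal_le_ofReal (rpow_le_mul_rpow_of_comparable (by positivity) (by positivity)
    two_pos ?_ ?_ α) <;> nlinarith [Nat.cast_nonneg (α := ℝ) j]

theorem logWeight_le_rpow_mul_weight (q : ℝ≥0∞) (α : ℝ) {j k : ℕ} (h1 : 2 ^ j ≤ 2 * (k + 1))
    (h2 : k + 1 ≤ 2 ^ j) :
    logWeight α j ≤ 2 ^ |α| * (((2 : ℝ≥0∞) ^ j) ^ (q⁻¹).toReal * weight q α (k + 1)) := by
  have hk : (0 : ℝ) < k + 1 := by positivity
  refine (logWeight_le_ofReal_one_add_abs_log_rpow α h1 h2).trans ?_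
  gcongr
  calc ENNReal.ofReal ((1 + |Real.log ((k : ℝ) + 1)|) ^ α)
      = ENNReal.ofReal (((k : ℝ) + 1) ^ (q⁻¹).toReal) * weight q α (k + 1) := by
        rw [weight, ← ENNReal.ofReal_mul (by positivity), ← mul_assoc, ← Real.rpow_add hk,
          add_neg_cancel, Real.rpow_zero, one_mul]
    _ ≤ ((2 : ℝ≥0∞) ^ j) ^ (q⁻¹).toReal * weight q α (k + 1) := by
        rw [← ENNReal.ofReal_rpow_of_pos hk]
        gcongr
        rw [ENNReal.ofReal_le_iff_le_toReal (by simp)]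
        simpa using (by exact_mod_cast h2 : (k : ℝ) + 1 ≤ 2 ^ j)

theorem tsum_two_rpow_mul_logWeight_ne_top {δ : ℝ} (hδ : 0 < δ) (β : ℝ) :
    ∑' i : ℕ, (2 : ℝ≥0∞) ^ (-(i : ℝ) * δ) * logWeight β i ≠ ∞ := by
  set r : ℝ := 2 ^ (-δ)
  have hr0 : 0 < r := by positivity
  have hr1 : r < 1 := Real.rpow_lt_one_of_one_lt_of_neg one_lt_two (by linarith)
  obtain ⟨N, hN⟩ := exists_nat_ge β
  have hs : Summable fun i : ℕ => r⁻¹ * (((i + 1 : ℕ) : ℝ) ^ N * r ^ (i + 1)) :=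
    ((summable_nat_add_iff (f := fun i : ℕ => (i : ℝ) ^ N * r ^ i) 1).2
      (summable_pow_mul_geometric_of_norm_lt_one N
        (by rwa [Real.norm_eq_abs, abs_of_pos hr0]))).mul_left _
  refine ne_top_of_le_ne_top hs.tsum_ofReal_ne_top (ENNReal.tsum_le_tsum fun i => ?_)
  rw [logWeight, ← ofReal_two_rpow, ← ENNReal.ofReal_mul (by positivity)]
  refine ENNReal.ofReal_le_ofReal ?_
  calc (2 : ℝ) ^ (-(i : ℝ) * δ) * (1 + (i : ℝ)) ^ β = r ^ i * (1 + (i : ℝ)) ^ β := by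
        rw [← Real.rpow_mul_natCast zero_le_two, neg_mul_comm, mul_comm (i : ℝ)]
    _ ≤ r ^ i * (1 + (i : ℝ)) ^ (N : ℝ) := by
        gcongr
        simp
    _ = r⁻¹ * (((i + 1 : ℕ) : ℝ) ^ N * r ^ (i + 1)) := by
        rw [Real.rpow_natCast]
        push_cast
        field_simp
        ring

theorem Ioo_zero_one_subset_iUnion_dyadic :
    Set.Ioo (0 : ℝ) 1 ⊆ ⋃ n : ℕ, Set.Ioc ((2 : ℝ)⁻¹ ^ (n + 1)) ((2 : ℝ)⁻¹ ^ n) := fun t ht =>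
  have ⟨n, hn⟩ := exists_nat_pow_near_of_lt_one ht.1 ht.2.le (y := (2 : ℝ)⁻¹) (by norm_num)
    (by norm_num)
  Set.mem_iUnion.2 ⟨n, hn⟩

theorem volume_Ioc_two_inv_pow (n : ℕ) :
    volume (Set.Ioc ((2 : ℝ)⁻¹ ^ (n + 1)) ((2 : ℝ)⁻¹ ^ n)) =
      ENNReal.ofReal ((2 : ℝ)⁻¹ ^ (n + 1)) := by
  rw [Real.volume_Ioc]
  congr 1
  ring

theorem normLL_le_mul_eLpNorm_count {q : ℝ≥0∞} (hq : q ≠ 0) (α : ℝ) (f : ℝ → ℂ) :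
    normLL q α f ≤ 2 ^ |α| *
      eLpNorm (fun n => logWeight α n * funHead f ((2 : ℝ)⁻¹ ^ n)) q Measure.count := by
  set I : ℕ → Set ℝ := fun n => Set.Ioc ((2 : ℝ)⁻¹ ^ (n + 1)) ((2 : ℝ)⁻¹ ^ n)
  calc normLL q α f
      = eLpNorm (fun t => weight q α t * funHead f t) q (volume.restrict (Set.Ioo 0 1)) :=
        normLL_eq_eLpNorm_weight_mul_funHead q α f
    _ ≤ eLpNorm (fun t => weight q α t * funHead f t) q (volume.restrict (⋃ n, I n)) :=
        eLpNorm_mono_measure _ (Measure.restrict_mono_set _ Ioo_zero_one_subset_iUnion_dyadic)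
    _ ≤ eLpNorm (fun n => 2 ^ |α| * logWeight α n * funHead f ((2 : ℝ)⁻¹ ^ n)) q
          Measure.count := by
        refine eLpNorm_restrict_iUnion_le_eLpNorm_count hq (fun n => measurableSet_Ioc)
          (fun n => by simp [I]) fun n t ht => ?_
        rw [← mul_assoc, volume_Ioc_two_inv_pow]
        exact mul_le_mul' (rpow_mul_weight_le_of_mem_Ioc q α ht) (monotone_funHead f ht.2)
    _ ≤ _ := eLpNorm_count_le_mul (fun n => (mul_assoc _ _ _).le) q

theorem pairwise_disjoint_Ico_two_pow :
    Pairwise (Function.onFun Disjoint fun j : ℕ => Set.Ico (2 ^ j / 2) (2 ^ j)) := by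
  have hmono : Monotone fun j : ℕ => 2 ^ j / 2 := fun i j hij =>
    Nat.div_le_div_right (Nat.pow_le_pow_right two_pos hij)
  simpa [pow_succ] using hmono.pairwise_disjoint_on_Ico_succ

theorem count_Ico (a b : ℕ) : Measure.count (Set.Ico a b) = (b - a : ℕ) := by
  rw [← Finset.coe_Ico, Measure.count_apply_finset, Nat.card_Ico]

theorem eLpNorm_count_l2Tail_two_pow_le {q : ℝ≥0∞} (hq : q ≠ 0) (α : ℝ) {ι : Type*} (c : ι → ℂ) :
    eLpNorm (fun j => logWeight α j * l2Tail (seqRearr c) (2 ^ j - 1)) q Measure.count ≤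
      2 ^ (|α| + (q⁻¹).toReal) * normlR q α c := by
  refine (eLpNorm_count_le_eLpNorm_of_disjoint hq (fun j => measurableSet_Ico)
    pairwise_disjoint_Ico_two_pow (fun j => ?_) (fun j => ?_) fun j k hk => ?_).trans
    (eLpNorm_count_le_mul (g := fun k => 2 ^ (|α| + (q⁻¹).toReal) * tailTerm q α c k)
      (fun k => le_rfl) q)
  · have := Nat.one_le_two_pow (n := j)
    rw [count_Ico, Nat.cast_ne_zero]
    omega
  · rw [count_Ico]
    exact ENNReal.natCast_ne_top _
  · obtain ⟨hk1, hk2⟩ := hk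
    have hcard : (2 : ℝ≥0∞) ^ j ≤ 2 * Measure.count (Set.Ico (2 ^ j / 2) (2 ^ j)) := by
      rw [count_Ico]
      exact_mod_cast (by omega : 2 ^ j ≤ 2 * (2 ^ j - 2 ^ j / 2))
    rw [tailTerm_eq_weight_mul_l2Tail]
    set N : ℝ≥0∞ := Measure.count (Set.Ico (2 ^ j / 2) (2 ^ j))
    calc logWeight α j * l2Tail (seqRearr c) (2 ^ j - 1)
        ≤ 2 ^ |α| * ((2 * N) ^ (q⁻¹).toReal * weight q α (k + 1)) * l2Tail (seqRearr c) k := by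
          refine mul_le_mul' ?_ (antitone_l2Tail _ (by omega))
          refine (logWeight_le_rpow_mul_weight q α (by omega) hk2).trans ?_
          gcongr
      _ = N ^ (q⁻¹).toReal * (2 ^ (|α| + (q⁻¹).toReal) *
            (weight q α (k + 1) * l2Tail (seqRearr c) k)) := by
          rw [ENNReal.mul_rpow_of_nonneg _ _ ENNReal.toReal_nonneg, ← two_rpow_mul_two_rpow]
          ring

/-! ### A discrete Hardy inequality -/

theorem eLpNorm_two_rpow_ne_top {q : ℝ≥0∞} (hq : q ≠ 0) {δ : ℝ} (hδ : 0 < δ) :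
    eLpNorm (fun i : ℕ => (2 : ℝ≥0∞) ^ (-(i : ℝ) * δ)) q Measure.count ≠ ∞ := by
  rcases eq_or_ne q ∞ with rfl | hq'
  · rw [eLpNorm_exponent_top, eLpNormEssSup_count]
    refine ne_top_of_le_ne_top ENNReal.one_ne_top (iSup_le fun i => ?_)
    have hexp : -(i : ℝ) * δ ≤ 0 := mul_nonpos_of_nonpos_of_nonneg (by simp) hδ.le
    exact (ENNReal.rpow_le_rpow_of_exponent_le one_le_two hexp).trans_eq ENNReal.rpow_zero
  have hq0 := ENNReal.toReal_pos hq hq'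
  have hsum := tsum_two_rpow_mul_logWeight_ne_top (mul_pos hδ hq0) 0
  simp only [logWeight, Real.rpow_zero, ENNReal.ofReal_one, mul_one, ← mul_assoc,
    ENNReal.rpow_mul _ _ q.toReal, ← eLpNorm_count_rpow_toReal hq hq'] at hsum
  exact fun htop => hsum (by rw [htop, ENNReal.top_rpow_of_pos hq0])

theorem logWeight_mul_le_of_le_sum_antidiagonal (α : ℝ) {δ : ℝ} {a : ℕ → ℝ≥0∞} {B : ℝ≥0∞}
    {m l : ℕ} (h : B ≤ ∑ p ∈ antidiagonal m, (2 : ℝ≥0∞) ^ (-(p.2 : ℝ) * δ) * a p.1) :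
    logWeight α (m + l) * B ≤ logWeight |α| l * ∑ p ∈ antidiagonal m,
      (2 : ℝ≥0∞) ^ (-(p.2 : ℝ) * (δ / 2)) * logWeight |α| p.2 *
        (logWeight α p.1 * a p.1 * 2 ^ (-(p.2 : ℝ) * (δ / 2))) := by
  refine (mul_le_mul' (logWeight_add_le α m l) h).trans ?_
  rw [mul_assoc, Finset.mul_sum]
  refine mul_le_mul' le_rfl (Finset.sum_le_sum fun p hp => ?_)
  have hhalf : (2 : ℝ≥0∞) ^ (-(p.2 : ℝ) * δ) =
      2 ^ (-(p.2 : ℝ) * (δ / 2)) * 2 ^ (-(p.2 : ℝ) * (δ / 2)) := by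
    rw [two_rpow_mul_two_rpow]
    ring_nf
  calc logWeight α m * (2 ^ (-(p.2 : ℝ) * δ) * a p.1)
      ≤ logWeight |α| p.2 * logWeight α p.1 * (2 ^ (-(p.2 : ℝ) * δ) * a p.1) := by
        gcongr
        rw [← mem_antidiagonal.1 hp]
        exact logWeight_add_le α p.1 p.2
    _ = _ := by
        rw [hhalf]
        ring

theorem exists_eLpNorm_logWeight_mul_le {q : ℝ≥0∞} (hq : q ≠ 0) (α : ℝ) {δ : ℝ} (hδ : 0 < δ) :
    ∃ C : ℝ≥0, ∀ (a F : ℕ → ℝ≥0∞) (l : ℕ), (∀ n, F n ≤ a 0) →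
      (∀ m, F (m + l) ≤ ∑ p ∈ antidiagonal m, (2 : ℝ≥0∞) ^ (-(p.2 : ℝ) * δ) * a p.1) →
      eLpNorm (fun n => logWeight α n * F n) q Measure.count ≤
        C * logWeight (|α| + (q⁻¹).toReal) l *
          eLpNorm (fun n => logWeight α n * a n) q Measure.count := by
  set z : ℕ → ℝ≥0∞ := fun i => 2 ^ (-(i : ℝ) * (δ / 2))
  set W := ∑' i, z i * logWeight |α| i
  set Z := eLpNorm z q Measure.count
  have hW : W ≠ ∞ := tsum_two_rpow_mul_logWeight_ne_top (half_pos hδ) |α|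
  have hZ : Z ≠ ∞ := eLpNorm_two_rpow_ne_top hq (half_pos hδ)
  have hz0 : z 0 = 1 := by simp [z]
  have hW1 : 1 ≤ W :=
    calc 1 = z 0 * logWeight |α| 0 := by simp [hz0]
      _ ≤ W := ENNReal.le_tsum 0
  have hZ1 : 1 ≤ Z := hz0.symm.trans_le (enorm_le_eLpNorm_count z 0 hq)
  refine ⟨(W * Z).toNNReal, fun a F l hF0 hF => ?_⟩
  rw [ENNReal.coe_toNNReal (ENNReal.mul_ne_top hW hZ)]
  set N := eLpNorm (fun n => logWeight α n * a n) q Measure.count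
  have ha0 : a 0 ≤ N := by
    simpa using enorm_le_eLpNorm_count (fun n => logWeight α n * a n) 0 hq
  have hhead : ∀ n < l, logWeight α n * F n ≤ logWeight |α| l * (W * (N * Z)) := fun n hn =>
    mul_le_mul' (logWeight_le_logWeight_abs hn.le) <| (hF0 n).trans <| ha0.trans <|
      (le_mul_of_one_le_right' hZ1).trans (le_mul_of_one_le_left' hW1)
  have htail : eLpNorm (fun m => logWeight α (m + l) * F (m + l)) q Measure.count ≤
      logWeight |α| l * (W * (N * Z)) :=
    (eLpNorm_count_le_mul (fun m => logWeight_mul_le_of_le_sum_antidiagonal α (hF m)) q).trans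
      (mul_le_mul' le_rfl (eLpNorm_sum_antidiagonal_mul_le hq (fun n => logWeight α n * a n) z
        fun i => z i * logWeight |α| i))
  refine (eLpNorm_count_le_of_eLpNorm_comp_add_le hq hhead htail).trans_eq ?_
  rw [← one_add_rpow_mul_logWeight ENNReal.toReal_nonneg]
  ring

/-! ### The norm inequality -/

theorem exists_nat_le_two_rpow_half {M : ℝ} (hM : 1 ≤ M) :
    ∃ l : ℕ, M ≤ 2 ^ ((l : ℝ) / 2) ∧ 1 + (l : ℝ) ≤ 3 * (1 + Real.log M) := by
  have hlog2 := Real.log_two_gt_d9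
  have hlog0 : 0 < Real.log 2 := by linarith
  have hlogM : 0 ≤ Real.log M := Real.log_nonneg hM
  have hceil := Nat.le_ceil (2 * Real.log M / Real.log 2)
  have hceil' := Nat.ceil_lt_add_one (a := 2 * Real.log M / Real.log 2) (by positivity)
  refine ⟨⌈2 * Real.log M / Real.log 2⌉₊, ?_, ?_⟩
  · rw [← Real.log_le_log_iff (by linarith) (by positivity), Real.log_rpow two_pos]
    rw [div_le_iff₀ hlog0] at hceil
    linarith
  · have : 2 * Real.log M / Real.log 2 ≤ 3 * Real.log M := by
      rw [div_le_iff₀ hlog0]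
      nlinarith
    linarith

theorem one_add_log_rpow_le_mul {a M : ℝ} (ha : 0 ≤ a) (hM : 1 ≤ M) :
    (1 + Real.log M) ^ a ≤ (a + 1) ^ (a + 1) * M := by
  have hlogM : 0 ≤ Real.log M := Real.log_nonneg hM
  have hexp : 1 + Real.log M ≤ (a + 1) * Real.exp (Real.log M / (a + 1)) :=
    calc 1 + Real.log M ≤ (a + 1) * (Real.log M / (a + 1) + 1) := by
          rw [mul_add, mul_div_cancel₀ _ (by positivity)]
          linarith
      _ ≤ (a + 1) * Real.exp (Real.log M / (a + 1)) := by
          gcongr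
          exact Real.add_one_le_exp _
  calc (1 + Real.log M) ^ a ≤ (1 + Real.log M) ^ (a + 1) :=
        Real.rpow_le_rpow_of_exponent_le (by linarith) (by linarith)
    _ ≤ ((a + 1) * Real.exp (Real.log M / (a + 1))) ^ (a + 1) := by gcongr
    _ = (a + 1) ^ (a + 1) * M := by
        rw [Real.mul_rpow (by positivity) (by positivity), ← Real.exp_mul,
          div_mul_cancel₀ _ (by positivity), Real.exp_log (by positivity)]

theorem exists_logWeight_le_mul_min {a ε : ℝ} (ha : 0 ≤ a) (hε : 0 ≤ ε) :
    ∃ K : ℝ≥0, ∀ M : ℝ≥0, 1 ≤ M → ∃ l : ℕ, (M : ℝ≥0∞) ≤ 2 ^ ((l : ℝ) / 2) ∧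
      logWeight a l ≤ K * ENNReal.ofReal (min M ((1 + Real.log M) ^ (a + ε))) := by
  have hK : (1 : ℝ) ≤ (a + 1) ^ (a + 1) := Real.one_le_rpow (by linarith) (by linarith)
  refine ⟨Real.toNNReal (3 ^ a * (a + 1) ^ (a + 1)), fun M (hM : (1 : ℝ) ≤ M) => ?_⟩
  obtain ⟨l, hMl, hl⟩ := exists_nat_le_two_rpow_half hM
  have hlogM : 0 ≤ Real.log M := Real.log_nonneg hM
  refine ⟨l, ?_, ?_⟩
  · rw [← ofReal_two_rpow, ← ENNReal.ofReal_coe_nnreal]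
    exact ENNReal.ofReal_le_ofReal hMl
  change _ ≤ ENNReal.ofReal _ * _
  rw [logWeight, ← ENNReal.ofReal_mul (by positivity)]
  refine ENNReal.ofReal_le_ofReal ?_
  calc (1 + (l : ℝ)) ^ a ≤ (3 * (1 + Real.log M)) ^ a := by gcongr
    _ = 3 ^ a * (1 + Real.log M) ^ a := Real.mul_rpow (by norm_num) (by positivity)
    _ ≤ 3 ^ a * ((a + 1) ^ (a + 1) * min (M : ℝ) ((1 + Real.log M) ^ (a + ε))) := by
        gcongr
        rw [mul_min_of_nonneg _ _ (by positivity)]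
        refine le_min (one_add_log_rpow_le_mul ha hM) ?_
        exact (Real.rpow_le_rpow_of_exponent_le (by linarith) (by linarith)).trans
          (le_mul_of_one_le_left (by positivity) hK)
    _ = 3 ^ a * (a + 1) ^ (a + 1) * min (M : ℝ) ((1 + Real.log M) ^ (a + ε)) := by ring

theorem l2Tail_zero_le_normlR {ι : Type*} {q : ℝ≥0∞} (hq : q ≠ 0) (α : ℝ) (c : ι → ℂ) :
    l2Tail (seqRearr c) 0 ≤ normlR q α c := by
  have hweight : weight q α 1 = 1 := by simp [weight]
  simpa [tailTerm_eq_weight_mul_l2Tail, hweight, normlR] using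
    enorm_le_eLpNorm_count (tailTerm q α c) 0 hq

theorem exists_normLL_le_mul_normlR {q : ℝ≥0∞} (hq : q ≠ 0) (α : ℝ) :
    ∃ C : ℝ≥0, ∀ {ι : Type*} {φ : ι → Lp ℂ 2 unitMeasure} {M : ℝ≥0∞} {l : ℕ},
      Orthonormal ℂ φ → (∀ n, eLpNorm (φ n) ∞ unitMeasure ≤ M) → M ≤ 2 ^ ((l : ℝ) / 2) →
      ∀ ⦃c : ι → ℂ⦄ ⦃f : Lp ℂ 2 unitMeasure⦄, normlR q α c ≠ ∞ → HasSum (fun n => c n • φ n) f →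
        normLL q α f ≤ C * logWeight (|α| + (q⁻¹).toReal) l * normlR q α c := by
  obtain ⟨C, hC⟩ := exists_eLpNorm_logWeight_mul_le hq α one_half_pos
  have hK : (2 : ℝ≥0∞) ^ |α| * C * 2 ^ (|α| + (q⁻¹).toReal) ≠ ∞ :=
    ENNReal.mul_ne_top (ENNReal.mul_ne_top (by simp) ENNReal.coe_ne_top) (by simp)
  refine ⟨((2 : ℝ≥0∞) ^ |α| * C * 2 ^ (|α| + (q⁻¹).toReal)).toNNReal, fun hφ hM hMl c f hc hf => ?_⟩
  rw [ENNReal.coe_toNNReal hK]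
  have hc0 := ne_top_of_le_ne_top hc (l2Tail_zero_le_normlR hq α c)
  calc normLL q α f
      ≤ 2 ^ |α| * eLpNorm (fun n => logWeight α n * funHead f ((2 : ℝ)⁻¹ ^ n)) q Measure.count :=
        normLL_le_mul_eLpNorm_count hq α f
    _ ≤ 2 ^ |α| * (C * logWeight (|α| + (q⁻¹).toReal) _ *
          eLpNorm (fun j => logWeight α j * l2Tail (seqRearr c) (2 ^ j - 1)) q Measure.count) := by
        gcongr
        exact hC _ _ _ (fun n => by simpa using funHead_le_l2Tail_zero hφ hM hc0 hf _)
          (funHead_two_inv_pow_add_le hφ hM hc0 hf hMl)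
    _ ≤ 2 ^ |α| * (C * logWeight (|α| + (q⁻¹).toReal) _ *
          (2 ^ (|α| + (q⁻¹).toReal) * normlR q α c)) := by
        gcongr
        exact eLpNorm_count_l2Tail_two_pow_le hq α c
    _ = _ := by ring

/-! ### Remainders -/

section Remainders

variable {ι : Type*} {q : ℝ≥0∞} {c d : ι → ℂ}

theorem tailTerm_mono (h : ∀ i, ‖d i‖ₑ ≤ ‖c i‖ₑ) (q : ℝ≥0∞) (α : ℝ) (k : ℕ) :
    tailTerm q α d k ≤ tailTerm q α c k := by
  unfold tailTerm
  gcongr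
  exact seqRearr_mono h _

theorem normlR_mono (h : ∀ i, ‖d i‖ₑ ≤ ‖c i‖ₑ) (q : ℝ≥0∞) (α : ℝ) :
    normlR q α d ≤ normlR q α c :=
  eLpNorm_mono_enorm fun k => tailTerm_mono h q α k

theorem tendsto_seqRearr_indicator_compl (hc : Tendsto (‖c ·‖ₑ) cofinite (𝓝 0)) (k : ℕ) :
    Tendsto (fun F : Finset ι => seqRearr ((F : Set ι)ᶜ.indicator c) k) atTop (𝓝 0) := by
  rw [ENNReal.tendsto_nhds_zero]
  intro ε hε
  have hfin := eventually_cofinite.1 (ENNReal.tendsto_nhds_zero.1 hc ε hε)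
  filter_upwards [eventually_ge_atTop hfin.toFinset] with F hF
  refine (seqRearr_le_iSup _ k).trans (iSup_le fun i => ?_)
  by_cases hi : i ∈ F
  · simp [hi]
  · have hiε : ‖c i‖ₑ ≤ ε := not_not.1 fun h => hi (hF (hfin.mem_toFinset.2 h))
    simpa [hi] using hiε

theorem tendsto_tailTerm_indicator_compl (hc : l2Tail (seqRearr c) 0 ≠ ∞) (q : ℝ≥0∞) (α : ℝ)
    (k : ℕ) :
    Tendsto (fun F : Finset ι => tailTerm q α ((F : Set ι)ᶜ.indicator c) k) atTop (𝓝 0) := by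
  have htail : Tendsto (fun F : Finset ι => l2Tail (seqRearr ((F : Set ι)ᶜ.indicator c)) k)
      atTop (𝓝 0) :=
    tendsto_eLpNorm_count_nhds_zero_of_dominated two_ne_zero
      (ne_top_of_le_ne_top hc (antitone_l2Tail _ k.zero_le)) (.inl ENNReal.ofNat_ne_top)
      (fun F i => seqRearr_mono (fun n => enorm_indicator_le_enorm_self c n) _)
      fun i => tendsto_seqRearr_indicator_compl (tendsto_enorm_cofinite_of_l2Tail_ne_top hc) _
  have hweight : weight q α (k + 1) ≠ ∞ := ENNReal.ofReal_ne_top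
  simpa only [tailTerm_eq_weight_mul_l2Tail, mul_zero] using
    ENNReal.Tendsto.const_mul htail (.inr hweight)

theorem tendsto_normlR_indicator_compl (hq : q ≠ 0) {α : ℝ} (hc : normlR q α c ≠ ∞)
    (hlim : q ≠ ∞ ∨ Tendsto (tailTerm q α c) atTop (𝓝 0)) :
    Tendsto (fun F : Finset ι => normlR q α ((F : Set ι)ᶜ.indicator c)) atTop (𝓝 0) :=
  tendsto_eLpNorm_count_nhds_zero_of_dominated hq hc hlim
    (fun _ k => tailTerm_mono (fun n => enorm_indicator_le_enorm_self c n) q α k)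
    fun k => tendsto_tailTerm_indicator_compl
      (ne_top_of_le_ne_top hc (l2Tail_zero_le_normlR hq α c)) q α k

end Remainders

theorem exists_hasSum_smul_of_normlR_ne_top {ι H : Type*} [NormedAddCommGroup H]
    [InnerProductSpace ℂ H] [CompleteSpace H] {φ : ι → H} (hφ : Orthonormal ℂ φ) {q : ℝ≥0∞}
    (hq : q ≠ 0) {α : ℝ} {c : ι → ℂ} (hc : normlR q α c ≠ ∞) :
    ∃ f, HasSum (fun n => c n • φ n) f := by
  have hc0 := ne_top_of_le_ne_top hc (l2Tail_zero_le_normlR hq α c)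
  exact summable_smul_of_orthonormal hφ
    (ne_top_of_le_ne_top (ENNReal.pow_ne_top hc0) (tsum_enorm_sq_le_l2Tail_sq hc0))

end LimitingFourier

open LimitingFourier

theorem theorem1p2_general {q : ℝ≥0∞} (hq : q ≠ 0) (α : ℝ) {ε : ℝ} (hε : 0 ≤ ε) :
    ∃ C : ℝ≥0, ∀ (ι : Type*) [Nonempty ι] (φ : ι → Lp ℂ 2 unitMeasure) (M : ℝ≥0),
      Orthonormal ℂ φ → (⨆ n, eLpNorm (φ n) ∞ unitMeasure) = (M : ℝ≥0∞) →
      ∀ c : ι → ℂ, normlR q α c < ∞ →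
        ∃ f : Lp ℂ 2 unitMeasure, HasSum (fun n => c n • φ n) f ∧
          normLL q α f ≤
            C * ENNReal.ofReal (min (M : ℝ) ((1 + Real.log M) ^ (|α| + ε + (q⁻¹).toReal))) *
              normlR q α c ∧
          (q ≠ ∞ ∨ Tendsto (tailTerm q α c) atTop (𝓝 0) →
            Tendsto (fun F : Finset ι => normLL q α
              (f - ∑ n ∈ F, c n • φ n : Lp ℂ 2 unitMeasure)) atTop (𝓝 0)) := by
  obtain ⟨C, hC⟩ := exists_normLL_le_mul_normlR hq α
  obtain ⟨K, hK⟩ := exists_logWeight_le_mul_min (a := |α| + (q⁻¹).toReal) (by positivity) hε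
  refine ⟨C * K, fun ι _ φ M hφ hM c hc => ?_⟩
  have : IsProbabilityMeasure unitMeasure := ⟨by simp⟩
  obtain ⟨l, hMl, hlK⟩ := hK M (by exact_mod_cast (one_le_iSup_eLpNorm_top hφ).trans_eq hM)
  have hbound := hC hφ (fun n => (le_iSup (fun n => eLpNorm (φ n) ∞ unitMeasure) n).trans_eq hM) hMl
  obtain ⟨f, hf⟩ := exists_hasSum_smul_of_normlR_ne_top hφ hq hc.ne
  refine ⟨f, hf, (hbound hc.ne hf).trans (mul_le_mul' ?_ le_rfl), fun hlim => ?_⟩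
  · rw [ENNReal.coe_mul, mul_assoc, add_right_comm]
    exact mul_le_mul' le_rfl hlK
  · have hconst : C * logWeight (|α| + (q⁻¹).toReal) l ≠ ∞ :=
      ENNReal.mul_ne_top ENNReal.coe_ne_top ENNReal.ofReal_ne_top
    have hmajorant := ENNReal.Tendsto.const_mul (tendsto_normlR_indicator_compl hq hc.ne hlim)
      (.inr hconst)
    rw [mul_zero] at hmajorant
    exact tendsto_of_tendsto_of_tendsto_of_le_of_le tendsto_const_nhds hmajorant
      (fun _ => zero_le) fun F => hbound (ne_top_of_le_ne_top hc.ne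
        (normlR_mono (fun n => enorm_indicator_le_enorm_self c n) q α))
        (hasSum_indicator_compl_smul hf F)

theorem theorem1p2 (q : ℝ≥0∞) (hq : q ≠ 0) (α : ℝ) (hα : -(q⁻¹).toReal < α)
    (ε : ℝ) (hε : 0 < ε) :
    ∃ C : ℝ≥0, ∀ (ι : Type) [Countable ι] [Nonempty ι]
      (φ : ι → Lp ℂ 2 LimitingFourier.unitMeasure) (M : ℝ≥0),
      Orthonormal ℂ φ →
      (⨆ n, eLpNorm (φ n) ∞ LimitingFourier.unitMeasure) = (M : ℝ≥0∞) →
      ∀ c : ι → ℂ, LimitingFourier.normlR q α c < ∞ →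
        ∃ f : Lp ℂ 2 LimitingFourier.unitMeasure,
          HasSum (fun n => c n • φ n) f ∧
          LimitingFourier.normLL q α f ≤
            C * ENNReal.ofReal
                (min (M : ℝ) ((1 + Real.log M) ^ (|α| + ε + (q⁻¹).toReal))) *
              LimitingFourier.normlR q α c ∧
          (q ≠ ∞ ∨ Tendsto (LimitingFourier.tailTerm q α c) atTop (𝓝 0) →
            Tendsto
              (fun F : Finset ι => LimitingFourier.normLL q α
                (f - ∑ n ∈ F, c n • φ n : Lp ℂ 2 LimitingFourier.unitMeasure))
              atTop (𝓝 0)) := by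
  obtain ⟨C, hC⟩ := theorem1p2_general hq α hε.le
  exact ⟨C, fun ι _ _ => hC ι⟩
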